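/- Let $G$ be a Carnot group: a simply connected real Lie group whose Lie algebra has a stratification $\mathfrak g=V_1\oplus V_2\oplus\cdots$ with $[V_1,V_i]=V_{i+1}$ for all $i\ge 1$ (so all but finitely many $V_i$ vanish), with dilations $\delta_t$, $t>0$ (the Lie group automorphisms whose differential at the identity is multiplication by $t^i$ on $V_i$), equipped with a homogeneous distance $d$, i.e. a left-invariant distance that induces the topology of $G$ and satisfies $d(\delta_t x,\delta_t y)=t\,d(x,y)$ (for example a Carnot-Carathéodory distance defined by a left-invariant norm on $V_1$). Let $N,H$ be homogeneous subgroups of $G$, i.e. closed and invariant under all $\delta_t$, with $N$ normal and $G=N\rtimes H$, so that every $g\in G$ is uniquely $g=\pi_N(g)\pi_H(g)$ with $\pi_N(g)\in N$ and $\pi_H(g)\in H$. For $\psi:N\to H$ put $\Gamma_\psi=\{n\psi(n): n\in N\}$, and call $\psi$ intrinsically Lipschitz in the sense of Franchi-Serapioni-Serra Cassano (FSSC) if there is $K>0$ with $$d(1,\pi_H(x^{-1}x'))\le K\,d(1,\pi_N(x^{-1}x'))\qquad\text{for all }x,x'\in\Gamma_\psi .$$ A set $A$ in a metric space is locally $Q$-Ahlfors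 regular with respect to a measure $m$ if for every $x\in A$ there are $r_0>0$ and $C>0$ with $C^{-1}r^Q\le m(B(x,r)\cap A)\le C r^Q$ for all $r\in(0,r_0)$. Then there is $Q\in[0,\infty)$, depending only on $N$ and $d$, such that $N$ is locally $Q$-Ahlfors regular with respect to its $Q$-dimensional Hausdorff measure $\mu_N=\mathcal H^Q$, and for every FSSC intrinsically Lipschitz map $\psi:N\to H$ the graph $\Gamma_\psi$ is locally $Q$-Ahlfors regular, both with respect to the push-forward of $\mu_N$ under the graph map $n\mapsto n\psi(n)$ and with respect to the $Q$-dimensional Hausdorff measure of $G$. -/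

import Mathlib

open scoped Manifold ContDiff ENNReal

noncomputable section

/-- The stratification and the dilations of a Carnot group. Here `G` is a real Lie group modelled
on the finite dimensional vector space `E`, with Lie algebra `GroupLieAlgebra 𝓘(ℝ, E) G`
(the tangent space at the identity, with the bracket of left-invariant vector fields).

* `layer i` is the `i`-th layer `V_i` of the stratification `𝔤 = V_1 ⊕ V_2 ⊕ ⋯`. Since `𝔤` is finite
  dimensional, all but finitely many layers vanish.
* `dil t`, for `t > 0`, is the dilation of factor `t`: the Lie group endomorphism whose differential
  at the identity is multiplication by `t ^ i` on `V_i`. The dilations form a one-parameter group.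
  The values of `dil t` for `t ≤ 0` carry no meaning. -/
structure CarnotStructure (E : Type*) [NormedAddCommGroup E] [NormedSpace ℝ E]
    (G : Type*) [TopologicalSpace G] [ChartedSpace E G] [Group G] where
  layer : ℕ → Submodule ℝ (GroupLieAlgebra 𝓘(ℝ, E) G)
  layer_zero : layer 0 = ⊥
  isInternal_layer : DirectSum.IsInternal layer
  bracket_layer : ∀ i : ℕ, 1 ≤ i →
    Submodule.span ℝ {z : GroupLieAlgebra 𝓘(ℝ, E) G |
      ∃ x ∈ layer 1, ∃ y ∈ layer i, ⁅x, y⁆ = z} = layer (i + 1)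
  dil : ℝ → G →* G
  dil_mul : ∀ s t : ℝ, 0 < s → 0 < t → ∀ g : G, dil (s * t) g = dil s (dil t g)
  contMDiff_dil : ∀ t : ℝ, 0 < t → ContMDiff 𝓘(ℝ, E) 𝓘(ℝ, E) ∞ (dil t)
  mfderiv_dil : ∀ t : ℝ, 0 < t → ∀ i : ℕ, ∀ v ∈ layer i,
    (mfderiv 𝓘(ℝ, E) 𝓘(ℝ, E) (dil t) (1 : G) v : E) = (t ^ i • v : E)

namespace CarnotStructure

/-- The distance of `G` is a homogeneous distance: it is left-invariant and the dilation of factor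
`t` multiplies it by `t`. (It induces the topology of `G`, since that is the topology of the metric
space `G`.) -/
structure IsHomogeneousDist {E : Type*} [NormedAddCommGroup E] [NormedSpace ℝ E]
    {G : Type*} [MetricSpace G] [ChartedSpace E G] [Group G] (S : CarnotStructure E G) : Prop where
  dist_mul_left : ∀ g x y : G, dist (g * x) (g * y) = dist x y
  dist_dil : ∀ t : ℝ, 0 < t → ∀ x y : G, dist (S.dil t x) (S.dil t y) = t * dist x y

/-- Homogeneous subgroups: closed subgroups that are invariant under the dilations. -/
structure IsHomogeneousSubgroup {E : Type*} [NormedAddCommGroup E] [NormedSpace ℝ E]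
    {G : Type*} [TopologicalSpace G] [ChartedSpace E G] [Group G] (S : CarnotStructure E G)
    (P : Subgroup G) : Prop where
  isClosed : IsClosed (P : Set G)
  dil_mem : ∀ t : ℝ, 0 < t → ∀ x ∈ P, S.dil t x ∈ P

end CarnotStructure

/-- For a splitting `G = N · H` (every `g` is uniquely `n * h` with `n ∈ N` and `h ∈ H`), the
projection `π_N : G → N`, `n * h ↦ n`. -/
def splitProjLeft {G : Type*} [Group G] {N H : Subgroup G} (hNH : Subgroup.IsComplement' N H)
    (g : G) : N :=
  (hNH.equiv g).1

/-- For a splitting `G = N · H`, the projection `π_H : G → H`, `n * h ↦ h`. -/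
def splitProjRight {G : Type*} [Group G] {N H : Subgroup G} (hNH : Subgroup.IsComplement' N H)
    (g : G) : H :=
  (hNH.equiv g).2

/-- The graph map `n ↦ n * ψ n` of `ψ : N → H`. -/
def graphMap {G : Type*} [Group G] {N H : Subgroup G} (ψ : N → H) (n : N) : G :=
  (n : G) * (ψ n : G)

/-- The graph `Γ_ψ = {n * ψ n : n ∈ N}` of `ψ : N → H`. -/
def intrinsicGraph {G : Type*} [Group G] {N H : Subgroup G} (ψ : N → H) : Set G :=
  Set.range (graphMap ψ)

/-- `ψ : N → H` is intrinsically Lipschitz in the sense of Franchi, Serapioni and Serra Cassano. -/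
def IsFSSCLipschitz {G : Type*} [MetricSpace G] [Group G] {N H : Subgroup G}
    (hNH : Subgroup.IsComplement' N H) (ψ : N → H) : Prop :=
  ∃ K : ℝ, 0 < K ∧ ∀ x ∈ intrinsicGraph ψ, ∀ x' ∈ intrinsicGraph ψ,
    dist (1 : G) (splitProjRight hNH (x⁻¹ * x') : G) ≤
      K * dist (1 : G) (splitProjLeft hNH (x⁻¹ * x') : G)

/-- The set `A` is locally `Q`-Ahlfors regular with respect to the measure `m`. -/
def IsLocallyAhlforsRegular {X : Type*} [MetricSpace X] [MeasurableSpace X]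
    (m : MeasureTheory.Measure X) (A : Set X) (Q : ℝ) : Prop :=
  ∀ x ∈ A, ∃ r₀ : ℝ, 0 < r₀ ∧ ∃ C : ℝ, 0 < C ∧ ∀ r : ℝ, 0 < r → r < r₀ →
    ENNReal.ofReal (C⁻¹ * r ^ Q) ≤ m (Metric.ball x r ∩ A) ∧
      m (Metric.ball x r ∩ A) ≤ ENNReal.ofReal (C * r ^ Q)

end

/-!
The argument is metric; the Lie structure of `G` enters only through local compactness and the
continuity of the group operations.

Since dilations multiply the distance, closed balls of `G`, and hence of `N`, are compact. The
dilation of factor `2` scales Haar measure on `N` by a constant `a ≥ 1`, so with `Q = log₂ a` the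
Haar measure of every ball of radius `r` in `N` is comparable to `r ^ Q`
(`exists_isUniformlyAhlforsRegular_of_dilation`). A measure that is Ahlfors `Q`-regular with
uniform constants can be replaced by the `Q`-dimensional Hausdorff measure: the lower bound is the
mass distribution principle, the upper bound comes from covering a ball by the balls around a
maximal separated set (`IsUniformlyAhlforsRegular.hausdorffMeasure`). This settles `N`, and shows
that its Hausdorff measure is a Haar measure.

For two points `x = n ψ(n)` and `x' = n' ψ(n')` of the graph, the `N`-component of `x⁻¹ x'` is
`n⁻¹ n'` conjugated by `ψ(n)⁻¹`. By the Lipschitz condition `d(x, x')` is at most a multiple of the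
distance of this component to `1`, and by the homogeneity of the projection
(`CarnotStructure.exists_dist_le_mul_dist_mul`) it is at least a multiple of it. So the graph map
pulls the ball `B(x, r)` back to a set between left translates of `ψ(n) B(1, ρ) ψ(n)⁻¹` with `ρ`
comparable to `r`. Conjugation by `g` changes the measure of all sets by one and the same factor,
and this factor is bounded independently of `g`: at scales above `2 d(1, g)`, conjugation maps a
ball around `1` into the ball of twice the radius, and regularity compares their measures
(`measure_image_le_of_dist_le`). Hence the push-forward measure is uniformly regular on the graph
(`IsFSSCLipschitz.measure_preimage_ball`), and the comparison with Hausdorff measure applies once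
more, on the graph as a metric space.
-/

open MeasureTheory Metric Set Filter
open scoped Topology NNReal Pointwise

/-- `m` is Ahlfors `Q`-regular with the same constants at all points and all scales. -/
def IsUniformlyAhlforsRegular {X : Type*} [MetricSpace X] [MeasurableSpace X]
    (m : Measure X) (Q : ℝ) : Prop :=
  ∃ c C : ℝ, 0 < c ∧ 0 < C ∧ ∀ (x : X) (r : ℝ), 0 < r →
    ENNReal.ofReal (c * r ^ Q) ≤ m (ball x r) ∧ m (ball x r) ≤ ENNReal.ofReal (C * r ^ Q)

/-! ### Comparison with Hausdorff measure -/

section MetricMeasure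

variable {X : Type*} [MetricSpace X] [MeasurableSpace X] {m : Measure X} {Q c C : ℝ}

theorem measure_closedBall_le_of_ball_le (hQ : 0 ≤ Q)
    (hm : ∀ (x : X) (r : ℝ), 0 < r → m (ball x r) ≤ ENNReal.ofReal (C * r ^ Q))
    (x : X) {r : ℝ} (hr : 0 ≤ r) : m (closedBall x r) ≤ ENNReal.ofReal (C * r ^ Q) := by
  have hcont : Continuous fun s : ℝ => ENNReal.ofReal (C * s ^ Q) :=
    ENNReal.continuous_ofReal.comp (continuous_const.mul (Real.continuous_rpow_const hQ))
  refine ge_of_tendsto ((hcont.tendsto r).mono_left (nhdsWithin_le_nhds (s := Ioi r))) ?_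
  filter_upwards [self_mem_nhdsWithin] with s hs
  exact (measure_mono (closedBall_subset_ball hs)).trans (hm x s (hr.trans_lt hs))

/-- The mass distribution principle. -/
theorem smul_le_hausdorffMeasure_of_ball_le [BorelSpace X] (hQ : 0 ≤ Q) (hC : 0 < C)
    (hm : ∀ (x : X) (r : ℝ), 0 < r → m (ball x r) ≤ ENNReal.ofReal (C * r ^ Q)) :
    ENNReal.ofReal C⁻¹ • m ≤ Measure.hausdorffMeasure Q := by
  refine Measure.le_hausdorffMeasure Q _ 1 one_pos fun s hs => ?_
  rcases s.eq_empty_or_nonempty with rfl | ⟨y, hy⟩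
  · simp
  have hfin : ediam s ≠ ⊤ := ne_top_of_le_ne_top ENNReal.one_ne_top hs
  have hsub : s ⊆ closedBall y (diam s) := fun z hz =>
    mem_closedBall.2 (dist_le_diam_of_mem (isBounded_iff_ediam_ne_top.2 hfin) hz hy)
  have hd : ediam s ^ Q = ENNReal.ofReal (diam s ^ Q) := by
    rw [← ENNReal.ofReal_rpow_of_nonneg diam_nonneg hQ, diam, ENNReal.ofReal_toReal hfin]
  rw [hd, Measure.smul_apply, smul_eq_mul]
  calc ENNReal.ofReal C⁻¹ * m s
      ≤ ENNReal.ofReal C⁻¹ * ENNReal.ofReal (C * diam s ^ Q) := by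
        gcongr
        exact (measure_mono hsub).trans (measure_closedBall_le_of_ball_le hQ hm y diam_nonneg)
    _ = ENNReal.ofReal (diam s ^ Q) := by
        rw [← ENNReal.ofReal_mul (by positivity), inv_mul_cancel_left₀ hC.ne']

/-- The balls of radius `ε / 2` around an `ε`-separated set are disjoint, which bounds its
cardinality by the ratio of measures. -/
theorem card_mul_le_of_isSeparated [OpensMeasurableSpace X] (hC : 0 < C)
    (hl : ∀ (x : X) (r : ℝ), 0 < r → ENNReal.ofReal (c * r ^ Q) ≤ m (ball x r))
    (hm : ∀ (x : X) (r : ℝ), 0 < r → m (ball x r) ≤ ENNReal.ofReal (C * r ^ Q))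
    (x : X) {r : ℝ} (hr : 0 < r) {ε : ℝ≥0} (hε : 0 < ε) (hεr : (ε : ℝ) ≤ r)
    (t : Finset X) (hts : (t : Set X) ⊆ ball x r) (ht : IsSeparated ε (t : Set X)) :
    (t.card : ℝ) * (c * ((ε : ℝ) / 2) ^ Q) ≤ C * (2 * r) ^ Q := by
  have hε' : (0 : ℝ) < ε := hε
  have hdisj : (t : Set X).PairwiseDisjoint fun y => ball y ((ε : ℝ) / 2) := by
    intro y hy z hz hyz
    apply ball_disjoint_ball
    have h : (ε : ℝ≥0∞) < edist y z := ht hy hz hyz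
    rw [edist_nndist, ENNReal.coe_lt_coe] at h
    have : (ε : ℝ) < dist y z := by exact_mod_cast h
    linarith
  have hsub : (⋃ y ∈ t, ball y ((ε : ℝ) / 2)) ⊆ ball x (2 * r) := by
    refine iUnion₂_subset fun y hy => ball_subset_ball' ?_
    have := mem_ball.1 (hts hy)
    linarith
  have key : ENNReal.ofReal ((t.card : ℝ) * (c * ((ε : ℝ) / 2) ^ Q))
      ≤ ENNReal.ofReal (C * (2 * r) ^ Q) :=
    calc ENNReal.ofReal ((t.card : ℝ) * (c * ((ε : ℝ) / 2) ^ Q))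
        = ∑ _y ∈ t, ENNReal.ofReal (c * ((ε : ℝ) / 2) ^ Q) := by
          rw [ENNReal.ofReal_mul (by positivity)]; simp
      _ ≤ ∑ y ∈ t, m (ball y ((ε : ℝ) / 2)) := by
          gcongr with y; exact hl y _ (by positivity)
      _ = m (⋃ y ∈ t, ball y ((ε : ℝ) / 2)) :=
          (measure_biUnion_finset hdisj fun _ _ => measurableSet_ball).symm
      _ ≤ m (ball x (2 * r)) := measure_mono hsub
      _ ≤ _ := hm x _ (by positivity)
  exact (ENNReal.ofReal_le_ofReal_iff (by positivity)).1 key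

/-- Covering by balls around a maximal `ε`-separated set. -/
theorem exists_finset_cover_ball [OpensMeasurableSpace X] (hc : 0 < c) (hC : 0 < C)
    (hl : ∀ (x : X) (r : ℝ), 0 < r → ENNReal.ofReal (c * r ^ Q) ≤ m (ball x r))
    (hm : ∀ (x : X) (r : ℝ), 0 < r → m (ball x r) ≤ ENNReal.ofReal (C * r ^ Q))
    (x : X) {r : ℝ} (hr : 0 < r) {ε : ℝ≥0} (hε : 0 < ε) (hεr : (ε : ℝ) ≤ r) :
    ∃ t : Finset X, ball x r ⊆ ⋃ y ∈ t, closedBall y (ε : ℝ) ∧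
      (t.card : ℝ) * (c * ((ε : ℝ) / 2) ^ Q) ≤ C * (2 * r) ^ Q := by
  have hε' : (0 : ℝ) < ε := hε
  obtain ⟨k, hk⟩ := exists_nat_ge (C * (2 * r) ^ Q / (c * ((ε : ℝ) / 2) ^ Q))
  have hcard : ∀ t : Finset X, (t : Set X) ⊆ ball x r → IsSeparated ε (t : Set X) →
      t.card ≤ k := by
    intro t h1 h2
    have := card_mul_le_of_isSeparated hC hl hm x hr hε hεr t h1 h2
    rw [← le_div_iff₀ (by positivity)] at this
    exact_mod_cast this.trans hk
  have hpack : packingNumber ε (ball x r) ≠ ⊤ := by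
    refine ne_top_of_le_ne_top (ENat.natCast_ne_top k) (iSup₂_le fun D hD => iSup_le fun hsep => ?_)
    by_contra! hlt
    obtain ⟨D', hD'D, hD'⟩ := exists_subset_encard_eq (k := ((k + 1 : ℕ) : ℕ∞)) (s := D)
      (by push_cast; exact Order.add_one_le_of_lt hlt)
    have hfin : D'.Finite := finite_of_encard_eq_coe hD'
    have := hcard hfin.toFinset (by simpa using hD'D.trans hD) (by
      simpa using hsep.subset hD'D)
    rw [hfin.encard_eq_coe_toFinset_card] at hD'
    have h3 : hfin.toFinset.card = k + 1 := by exact_mod_cast hD'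
    omega
  have hfin : (maximalSeparatedSet ε (ball x r)).Finite := by
    rw [← encard_ne_top_iff, encard_maximalSeparatedSet hpack]; exact hpack
  refine ⟨hfin.toFinset, fun z hz => ?_, ?_⟩
  · obtain ⟨y, hy, hzy⟩ := isCover_maximalSeparatedSet hpack hz
    have hzy' : edist z y ≤ ε := hzy
    rw [edist_nndist, ENNReal.coe_le_coe] at hzy'
    simp only [mem_iUnion]
    exact ⟨y, by simpa using hy, mem_closedBall.2 (by exact_mod_cast hzy')⟩
  · refine card_mul_le_of_isSeparated hC hl hm x hr hε hεr _ ?_ ?_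
    · simpa using maximalSeparatedSet_subset
    · simpa using isSeparated_maximalSeparatedSet

theorem hausdorffMeasure_ball_le [BorelSpace X] (hQ : 0 ≤ Q) (hc : 0 < c) (hC : 0 < C)
    (hl : ∀ (x : X) (r : ℝ), 0 < r → ENNReal.ofReal (c * r ^ Q) ≤ m (ball x r))
    (hm : ∀ (x : X) (r : ℝ), 0 < r → m (ball x r) ≤ ENNReal.ofReal (C * r ^ Q))
    (x : X) {r : ℝ} (hr : 0 < r) :
    Measure.hausdorffMeasure Q (ball x r) ≤ ENNReal.ofReal (C / c * 8 ^ Q * r ^ Q) := by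
  set ε : ℕ → ℝ≥0 := fun k => r.toNNReal / ((k : ℝ≥0) + 1) with hεdef
  have hε : ∀ k, 0 < ε k := fun k => div_pos (Real.toNNReal_pos.2 hr) (by positivity)
  have hεr : ∀ k, (ε k : ℝ) ≤ r := fun k => by
    have : (ε k : ℝ) = r / (k + 1) := by simp [hεdef, hr.le]
    rw [this]
    exact div_le_self hr.le (by linarith [k.cast_nonneg (α := ℝ)])
  have hε0 : Tendsto (fun k => ENNReal.ofReal (2 * ε k)) atTop (𝓝 0) := by
    have h1 : Tendsto (fun k : ℕ => 2 * (r * (1 / ((k : ℝ) + 1)))) atTop (𝓝 (2 * (r * 0))) :=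
      (tendsto_one_div_add_atTop_nhds_zero_nat.const_mul r).const_mul 2
    have h2 := ENNReal.tendsto_ofReal h1
    simp only [mul_zero, ENNReal.ofReal_zero] at h2
    refine h2.congr fun k => ?_
    congr 2
    simp [hεdef, hr.le, div_eq_mul_inv]
  choose t ht hcard using fun k =>
    exists_finset_cover_ball hc hC hl hm x hr (hε k) (hεr k)
  have hdiam : ∀ (k : ℕ) (y : X), ediam (closedBall y (ε k : ℝ)) ≤ ENNReal.ofReal (2 * ε k) :=
    fun k y => by
      refine ediam_le fun a ha b hb => ?_
      rw [edist_dist]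
      refine ENNReal.ofReal_le_ofReal ?_
      linarith [dist_triangle_right a b y, mem_closedBall.1 ha, mem_closedBall.1 hb]
  refine (Measure.hausdorffMeasure_le_liminf_sum (β := ℕ) (ι := fun k => t k) Q (ball x r)
    (fun k => ENNReal.ofReal (2 * ε k)) hε0 (fun k y => closedBall (y : X) (ε k : ℝ))
    (Eventually.of_forall fun k y => hdiam k y)
    (Eventually.of_forall fun k => (ht k).trans ?_)).trans ?_
  · rw [iUnion_subtype]
  · refine (liminf_le_liminf (Eventually.of_forall (fun k => ?_))).trans_eq
      (liminf_const (f := atTop (α := ℕ)) (ENNReal.ofReal (C / c * 8 ^ Q * r ^ Q)))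
    have hεk : (0 : ℝ) < ε k := hε k
    calc ∑ y : t k, ediam (closedBall (y : X) (ε k : ℝ)) ^ Q
        ≤ ∑ _y : t k, ENNReal.ofReal (2 * ε k) ^ Q := by
          gcongr; exact hdiam k _
      _ = ENNReal.ofReal ((t k).card * (2 * ε k) ^ Q) := by
          rw [ENNReal.ofReal_rpow_of_nonneg (by positivity) hQ,
            ENNReal.ofReal_mul (by positivity)]
          simp
      _ ≤ _ := by
          apply ENNReal.ofReal_le_ofReal
          have h4 : (2 * (ε k : ℝ)) ^ Q = 4 ^ Q * ((ε k : ℝ) / 2) ^ Q := by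
            rw [← Real.mul_rpow (by norm_num) (by positivity)]; ring_nf
          have h8 : (8 : ℝ) ^ Q * r ^ Q = 4 ^ Q * (2 * r) ^ Q := by
            rw [← Real.mul_rpow (by norm_num) hr.le, ← Real.mul_rpow (by norm_num) (by positivity)]
            ring_nf
          rw [mul_assoc, h8, h4, div_mul_eq_mul_div, le_div_iff₀ hc]
          have := mul_le_mul_of_nonneg_left (hcard k) (by positivity : (0 : ℝ) ≤ 4 ^ Q)
          linarith

theorem IsUniformlyAhlforsRegular.hausdorffMeasure [BorelSpace X] (hQ : 0 ≤ Q)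
    (h : IsUniformlyAhlforsRegular m Q) :
    IsUniformlyAhlforsRegular (Measure.hausdorffMeasure Q : Measure X) Q := by
  obtain ⟨c, C, hc, hC, h⟩ := h
  refine ⟨C⁻¹ * c, C / c * 8 ^ Q, by positivity, by positivity, fun x r hr => ⟨?_, ?_⟩⟩
  · refine le_trans ?_ (smul_le_hausdorffMeasure_of_ball_le hQ hC
      (fun x r hr => (h x r hr).2) (ball x r))
    rw [mul_assoc, ENNReal.ofReal_mul (by positivity), Measure.smul_apply, smul_eq_mul]
    gcongr
    exact (h x r hr).1
  · exact hausdorffMeasure_ball_le hQ hc hC (fun x r hr => (h x r hr).1)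
      (fun x r hr => (h x r hr).2) x hr

theorem IsLocallyAhlforsRegular.of_forall_ball {m : Measure X} {A : Set X}
    (hc : 0 < c) (hC : 0 < C)
    (h : ∀ x ∈ A, ∀ r : ℝ, 0 < r → ENNReal.ofReal (c * r ^ Q) ≤ m (ball x r ∩ A) ∧
      m (ball x r ∩ A) ≤ ENNReal.ofReal (C * r ^ Q)) :
    IsLocallyAhlforsRegular m A Q := by
  refine fun x hx => ⟨1, one_pos, max c⁻¹ C, lt_max_of_lt_right hC, fun r hr _ => ⟨?_, ?_⟩⟩
  · refine le_trans (ENNReal.ofReal_le_ofReal ?_) (h x hx r hr).1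
    gcongr
    rw [inv_le_comm₀ (lt_max_of_lt_right hC) hc]
    exact le_max_left _ _
  · refine (h x hx r hr).2.trans (ENNReal.ofReal_le_ofReal ?_)
    gcongr
    exact le_max_right _ _

end MetricMeasure

/-! ### Haar measure and dilations -/

section HaarMeasure

theorem image_ball_one_of_dist_eq_mul {N : Type*} [MetricSpace N] [Group N] {a : ℝ}
    (ha : 0 < a) {φ : N ≃ₜ* N} (hφ : ∀ x y, dist (φ x) (φ y) = a * dist x y) (r : ℝ) :
    φ '' ball 1 r = ball 1 (a * r) := by
  ext y
  constructor
  · rintro ⟨x, hx, rfl⟩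
    have h := hφ x 1
    rw [map_one] at h
    rw [mem_ball, h]
    exact mul_lt_mul_of_pos_left hx ha
  · intro hy
    refine ⟨φ.symm y, ?_, φ.apply_symm_apply y⟩
    have h := hφ (φ.symm y) 1
    rw [map_one, φ.apply_symm_apply] at h
    rw [mem_ball, h] at hy
    exact lt_of_mul_lt_mul_left hy ha.le

variable {N : Type*} [MetricSpace N] [Group N] [MeasurableSpace N]

theorem measure_ball_eq_measure_ball_one [IsIsometricSMul N N] (m : Measure N)
    [m.IsMulLeftInvariant] (x : N) (r : ℝ) : m (ball x r) = m (ball 1 r) := by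
  have h : x • ball (1 : N) r = ball x r := by rw [Metric.smul_ball, smul_eq_mul, mul_one]
  rw [← h, measure_smul]

variable [BorelSpace N] [IsTopologicalGroup N]

theorem IsUniformlyAhlforsRegular.isHaarMeasure [ProperSpace N] {m : Measure N}
    [m.IsMulLeftInvariant] {Q : ℝ} (h : IsUniformlyAhlforsRegular m Q) : m.IsHaarMeasure := by
  obtain ⟨c, C, hc, hC, h⟩ := h
  refine Measure.isHaarMeasure_of_isCompact_nonempty_interior m (closedBall 1 1)
    (isCompact_closedBall 1 1) ⟨1, ball_subset_interior_closedBall (mem_ball_self one_pos)⟩ ?_ ?_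
  · have h1 := (h 1 1 one_pos).1
    refine ((lt_of_lt_of_le ?_ h1).trans_le (measure_mono ball_subset_closedBall)).ne'
    exact ENNReal.ofReal_pos.2 (by positivity)
  · refine ne_top_of_le_ne_top ENNReal.ofReal_ne_top
      ((measure_mono (closedBall_subset_ball one_lt_two)).trans (h 1 2 two_pos).2)

variable [LocallyCompactSpace N]

theorem measure_image_continuousMulEquiv (m : Measure N) [m.IsHaarMeasure] [m.Regular]
    (φ : N ≃ₜ* N) (s : Set N) : m (φ '' s) = mulEquivHaarChar φ * m s := by
  have h := congrArg (fun μ : Measure N => μ s) (mulEquivHaarChar_smul_eq_comap m φ)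
  exact ((φ.toHomeomorph.measurableEmbedding.comap_apply m s).symm.trans h.symm)

/-- In a group with a left-invariant distance and an automorphism that multiplies the distance
by `2`, the measures of balls form a geometric sequence along the radii `2 ^ k`. The exponent of
regularity is therefore `log₂` of the factor by which the automorphism scales Haar measure. -/
theorem exists_isUniformlyAhlforsRegular_of_dilation [IsIsometricSMul N N] [ProperSpace N]
    (m : Measure N) [m.IsHaarMeasure] (φ : N ≃ₜ* N)
    (hφ : ∀ x y, dist (φ x) (φ y) = 2 * dist x y) :
    ∃ Q : ℝ, 0 ≤ Q ∧ IsUniformlyAhlforsRegular m Q := by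
  set a : ℝ := NNReal.toReal (mulEquivHaarChar φ) with ha_def
  have ha : 0 < a := NNReal.coe_pos.2 (mulEquivHaarChar_pos φ)
  set f : ℝ → ℝ := fun r => m.real (ball 1 r) with hf_def
  have hfin : ∀ r, m (ball 1 r) ≠ ⊤ := fun r => measure_ball_lt_top.ne
  have hf : ∀ r, m (ball 1 r) = ENNReal.ofReal (f r) := fun r =>
    (ENNReal.ofReal_toReal (hfin r)).symm
  have hmono : Monotone f := fun r s hrs =>
    ENNReal.toReal_mono (hfin s) (measure_mono (ball_subset_ball hrs))
  have hf1 : 0 < f 1 := ENNReal.toReal_pos (measure_ball_pos m 1 one_pos).ne' (hfin 1)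
  have hdouble : ∀ r, f (2 * r) = a * f r := fun r => by
    simp only [hf_def, Measure.real]
    rw [← image_ball_one_of_dist_eq_mul two_pos hφ, measure_image_continuousMulEquiv,
      ENNReal.toReal_mul]
    rfl
  have hzpow : ∀ k : ℤ, f ((2 : ℝ) ^ k) = a ^ k * f 1 := by
    intro k
    induction k with
    | zero => simp
    | succ k ih =>
      rw [zpow_add_one₀ two_ne_zero, mul_comm, hdouble, ih, zpow_add_one₀ ha.ne']; ring
    | pred k ih =>
      have h := hdouble ((2 : ℝ) ^ (-(k : ℤ) - 1))
      rw [← zpow_one_add₀ two_ne_zero, show (1 : ℤ) + (-k - 1) = -k by ring, ih] at h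
      rw [zpow_sub_one₀ ha.ne', mul_right_comm, h]
      field_simp
  have ha1 : 1 ≤ a := by
    have h := hmono (show (1 : ℝ) ≤ 2 * 1 by norm_num)
    rw [hdouble] at h
    exact (le_mul_iff_one_le_left hf1).1 h
  have hQ : 0 ≤ Real.logb 2 a := Real.logb_nonneg one_lt_two ha1
  have hpow : ∀ k : ℤ, a ^ k = ((2 : ℝ) ^ k) ^ Real.logb 2 a := fun k => by
    rw [← Real.rpow_intCast 2 k, ← Real.rpow_mul two_pos.le, mul_comm, Real.rpow_mul two_pos.le,
      Real.rpow_logb two_pos (by norm_num) ha, Real.rpow_intCast]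
  refine ⟨Real.logb 2 a, hQ, a⁻¹ * f 1, a * f 1, by positivity, by positivity, fun x r hr => ?_⟩
  obtain ⟨k, hk, hk'⟩ := exists_mem_Ico_zpow hr one_lt_two
  rw [measure_ball_eq_measure_ball_one, hf]
  constructor <;> apply ENNReal.ofReal_le_ofReal
  · calc a⁻¹ * f 1 * r ^ Real.logb 2 a
        ≤ a⁻¹ * f 1 * ((2 : ℝ) ^ (k + 1)) ^ Real.logb 2 a := by gcongr
      _ = f ((2 : ℝ) ^ k) := by
          rw [← hpow, hzpow, zpow_add_one₀ ha.ne']; field_simp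
      _ ≤ f r := hmono hk
  · calc f r ≤ f ((2 : ℝ) ^ (k + 1)) := hmono hk'.le
      _ = a * f 1 * ((2 : ℝ) ^ k) ^ Real.logb 2 a := by
          rw [← hpow, hzpow, zpow_add_one₀ ha.ne']; ring
      _ ≤ a * f 1 * r ^ Real.logb 2 a := by gcongr

/-- An automorphism that moves the distance to `1` by a bounded amount distorts an Ahlfors regular
Haar measure by a factor that does not depend on the amount. -/
theorem measure_image_le_of_dist_le {m : Measure N} [m.IsHaarMeasure] [m.Regular]
    {Q c C : ℝ} (hc : 0 < c) (hC : 0 < C)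
    (h : ∀ (x : N) (r : ℝ), 0 < r →
      ENNReal.ofReal (c * r ^ Q) ≤ m (ball x r) ∧ m (ball x r) ≤ ENNReal.ofReal (C * r ^ Q))
    {D : ℝ} (hD : 0 ≤ D) (φ : N ≃ₜ* N) (hφ : ∀ x, dist (φ x) 1 ≤ dist x 1 + D) (s : Set N) :
    m (φ '' s) ≤ ENNReal.ofReal (C / c * 2 ^ Q) * m s := by
  rw [measure_image_continuousMulEquiv]
  gcongr
  -- At radii larger than `D`, the image of a ball lies in the ball of twice the radius.
  have hR : 0 < D + 1 := by positivity
  have hsub : φ '' ball 1 (D + 1) ⊆ ball 1 (2 * (D + 1)) := by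
    rintro _ ⟨x, hx, rfl⟩
    have h1 := hφ x
    have h2 := mem_ball.1 hx
    rw [mem_ball]
    linarith
  have h1 : ENNReal.ofReal (mulEquivHaarChar φ * (c * (D + 1) ^ Q)) ≤
      ENNReal.ofReal (C * (2 * (D + 1)) ^ Q) := by
    rw [ENNReal.ofReal_mul (NNReal.coe_nonneg _), ENNReal.ofReal_coe_nnreal]
    calc (mulEquivHaarChar φ : ℝ≥0∞) * ENNReal.ofReal (c * (D + 1) ^ Q)
        ≤ mulEquivHaarChar φ * m (ball 1 (D + 1)) := by gcongr; exact (h 1 _ hR).1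
      _ = m (φ '' ball 1 (D + 1)) := (measure_image_continuousMulEquiv m φ _).symm
      _ ≤ m (ball 1 (2 * (D + 1))) := measure_mono hsub
      _ ≤ _ := (h 1 _ (by positivity)).2
  rw [ENNReal.ofReal_le_ofReal_iff (by positivity), Real.mul_rpow two_pos.le hR.le] at h1
  rw [← ENNReal.ofReal_coe_nnreal]
  apply ENNReal.ofReal_le_ofReal
  have hp : 0 < (D + 1) ^ Q := by positivity
  rw [div_mul_eq_mul_div, le_div_iff₀ hc]
  refine le_of_mul_le_mul_right ?_ hp
  linarith

end HaarMeasure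

/-! ### Intrinsic graphs -/

section Graph

variable {G : Type*}

theorem splitProjLeft_mul [Group G] {N H : Subgroup G}
    (hNH : Subgroup.IsComplement' N H) (n : N) (h : H) :
    splitProjLeft hNH ((n : G) * h) = n :=
  congrArg Prod.fst (hNH.equiv.apply_symm_apply (n, h))

theorem splitProjRight_mul [Group G] {N H : Subgroup G}
    (hNH : Subgroup.IsComplement' N H) (n : N) (h : H) :
    splitProjRight hNH ((n : G) * h) = h :=
  congrArg Prod.snd (hNH.equiv.apply_symm_apply (n, h))

variable [MetricSpace G] [Group G] {N H : Subgroup G}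

theorem dist_one_mul_le [IsIsometricSMul G G] (x y : G) :
    dist 1 (x * y) ≤ dist 1 x + dist 1 y := by
  have h : dist x (x * y) = dist 1 y := by rw [← dist_mul_left x 1 y, mul_one]
  exact h ▸ dist_triangle 1 x (x * y)

theorem dist_conj_le [IsIsometricSMul G G] (g x : G) :
    dist (g * x * g⁻¹) 1 ≤ dist x 1 + 2 * dist g 1 := by
  have h1 : dist (g * x * g⁻¹) (g * x) = dist g 1 := by
    conv_lhs => rw [← mul_one (g * x), mul_assoc (g * x), one_mul, dist_mul_left]
    rw [← dist_mul_left g, mul_inv_cancel, mul_one, dist_comm]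
  have h2 : dist (g * x) g = dist x 1 := by
    conv_lhs => rw [← mul_one g, mul_assoc, one_mul, dist_mul_left]
  linarith [dist_triangle4 (g * x * g⁻¹) (g * x) g 1]

variable [IsTopologicalGroup G]

/-- Conjugation by `g`, as an automorphism of the topological group `N`. -/
def conjContinuousMulEquiv (N : Subgroup G) [N.Normal] (g : G) : N ≃ₜ* N :=
  { MulAut.conjNormal g with
    continuous_toFun := by
      refine Continuous.subtype_mk (f := fun n : N => g * (n : G) * g⁻¹) ?_ _
      fun_prop
    continuous_invFun := by
      refine continuous_induced_rng.2 ?_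
      have : (Subtype.val ∘ (MulAut.conjNormal g : MulAut N).invFun) =
          fun n : N => g⁻¹ * (n : G) * g := funext fun n => MulAut.conjNormal_symm_apply g n
      rw [this]
      fun_prop }

theorem conjContinuousMulEquiv_apply [N.Normal] (g : G) (n : N) :
    (conjContinuousMulEquiv N g n : G) = g * n * g⁻¹ := rfl

theorem conjContinuousMulEquiv_symm_apply [N.Normal] (g : G) (n : N) :
    ((conjContinuousMulEquiv N g).symm n : G) = g⁻¹ * n * g :=
  MulAut.conjNormal_symm_apply g n

/-- The splitting of the difference of two points of the graph. -/
theorem graphMap_inv_mul_graphMap [N.Normal] (ψ : N → H) (n n' : N) :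
    (graphMap ψ n)⁻¹ * graphMap ψ n' =
      ((conjContinuousMulEquiv N (ψ n : G)).symm (n⁻¹ * n') : G) * ((ψ n)⁻¹ * ψ n' : H) := by
  rw [conjContinuousMulEquiv_symm_apply]
  simp only [graphMap, Subgroup.coe_mul, Subgroup.coe_inv]
  group

/-- The intrinsic Lipschitz condition in terms of `ψ`. -/
theorem IsFSSCLipschitz.exists_dist_le [N.Normal] {hNH : Subgroup.IsComplement' N H} {ψ : N → H}
    (hψ : IsFSSCLipschitz hNH ψ) : ∃ K : ℝ, 0 < K ∧ ∀ n n' : N,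
      dist (1 : G) ((ψ n)⁻¹ * ψ n' : H) ≤
        K * dist (1 : G) ((conjContinuousMulEquiv N (ψ n : G)).symm (n⁻¹ * n')) := by
  obtain ⟨K, hK, h⟩ := hψ
  refine ⟨K, hK, fun n n' => ?_⟩
  have := h _ (mem_range_self n) _ (mem_range_self n')
  rwa [graphMap_inv_mul_graphMap, splitProjLeft_mul, splitProjRight_mul] at this

variable [IsIsometricSMul G G]

theorem measure_image_conj_le [N.Normal] [LocallyCompactSpace N] [MeasurableSpace G] [BorelSpace G]
    {m : Measure N} [m.IsHaarMeasure] [m.Regular] {Q c C : ℝ} (hc : 0 < c) (hC : 0 < C)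
    (h : ∀ (x : N) (r : ℝ), 0 < r →
      ENNReal.ofReal (c * r ^ Q) ≤ m (ball x r) ∧ m (ball x r) ≤ ENNReal.ofReal (C * r ^ Q))
    (g : G) (s : Set N) :
    m (conjContinuousMulEquiv N g '' s) ≤ ENNReal.ofReal (C / c * 2 ^ Q) * m s :=
  measure_image_le_of_dist_le hc hC h (D := 2 * dist g 1) (by positivity) _
    (fun x => dist_conj_le g x) s

theorem measure_le_measure_image_conj [N.Normal] [LocallyCompactSpace N] [MeasurableSpace G]
    [BorelSpace G]
    {m : Measure N} [m.IsHaarMeasure] [m.Regular] {Q c C : ℝ} (hc : 0 < c) (hC : 0 < C)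
    (h : ∀ (x : N) (r : ℝ), 0 < r →
      ENNReal.ofReal (c * r ^ Q) ≤ m (ball x r) ∧ m (ball x r) ≤ ENNReal.ofReal (C * r ^ Q))
    (g : G) (s : Set N) :
    m s ≤ ENNReal.ofReal (C / c * 2 ^ Q) * m (conjContinuousMulEquiv N g '' s) := by
  have h1 := measure_image_conj_le hc hC h g⁻¹ (conjContinuousMulEquiv N g '' s)
  rw [← image_comp] at h1
  have : conjContinuousMulEquiv N g⁻¹ ∘ conjContinuousMulEquiv N g = id := by
    ext n
    simp only [Function.comp_apply, conjContinuousMulEquiv_apply, id]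
    group
  rwa [this, image_id] at h1

theorem dist_graphMap [N.Normal] (ψ : N → H) (n n' : N) :
    dist (graphMap ψ n) (graphMap ψ n') =
      dist (1 : G) (((conjContinuousMulEquiv N (ψ n : G)).symm (n⁻¹ * n') : G) *
        ((ψ n)⁻¹ * ψ n' : H)) := by
  rw [← graphMap_inv_mul_graphMap, ← dist_mul_left (graphMap ψ n)⁻¹, inv_mul_cancel]

theorem IsFSSCLipschitz.continuous_graphMap [N.Normal] {hNH : Subgroup.IsComplement' N H}
    {ψ : N → H} (hψ : IsFSSCLipschitz hNH ψ) : Continuous (graphMap ψ) := by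
  obtain ⟨K, hK, h⟩ := hψ.exists_dist_le
  refine continuous_iff_continuousAt.2 fun n => tendsto_iff_dist_tendsto_zero.2 ?_
  have hcont : Continuous fun n' : N =>
      (1 + K) * dist (1 : G) ((conjContinuousMulEquiv N (ψ n : G)).symm (n⁻¹ * n')) := by
    have := (conjContinuousMulEquiv N (ψ n : G)).symm.continuous
    fun_prop
  refine squeeze_zero (fun _ => dist_nonneg) (fun n' => ?_)
    (g := fun n' : N =>
      (1 + K) * dist (1 : G) ((conjContinuousMulEquiv N (ψ n : G)).symm (n⁻¹ * n')))
    (by simpa using hcont.tendsto n)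
  rw [dist_comm, dist_graphMap]
  refine (dist_one_mul_le _ _).trans ?_
  linarith [h n n']

/-- The graph map pulls the ball `B(n ψ(n), r)` back to a set between two left translates of
conjugates of balls around `1` in `N`, with radii comparable to `r`; conjugation does not change
the measure of these balls by more than a fixed factor. -/
theorem IsFSSCLipschitz.measure_preimage_ball [N.Normal] [LocallyCompactSpace N]
    [MeasurableSpace G] [BorelSpace G] {hNH : Subgroup.IsComplement' N H} {ψ : N → H}
    (hψ : IsFSSCLipschitz hNH ψ)
    {M : ℝ} (hM : 0 < M) (hproj : ∀ n ∈ N, ∀ h ∈ H, dist 1 n ≤ M * dist 1 (n * h))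
    {m : Measure N} [m.IsHaarMeasure] [m.Regular] {Q : ℝ} (hm : IsUniformlyAhlforsRegular m Q) :
    ∃ c C : ℝ, 0 < c ∧ 0 < C ∧ ∀ (n : N) (r : ℝ), 0 < r →
      ENNReal.ofReal (c * r ^ Q) ≤ m (graphMap ψ ⁻¹' ball (graphMap ψ n) r) ∧
        m (graphMap ψ ⁻¹' ball (graphMap ψ n) r) ≤ ENNReal.ofReal (C * r ^ Q) := by
  obtain ⟨K, hK, hψK⟩ := hψ.exists_dist_le
  obtain ⟨c, C, hc, hC, hm⟩ := hm
  set A : ℝ := C / c * 2 ^ Q with hA_def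
  have hA : 0 < A := by positivity
  refine ⟨A⁻¹ * (c * (1 + K)⁻¹ ^ Q), A * (C * M ^ Q), by positivity, by positivity,
    fun n r hr => ⟨?_, ?_⟩⟩
  · have hsub : n • (conjContinuousMulEquiv N (ψ n : G) '' ball 1 ((1 + K)⁻¹ * r)) ⊆
        graphMap ψ ⁻¹' ball (graphMap ψ n) r := by
      rintro _ ⟨_, ⟨y, hy, rfl⟩, rfl⟩
      have hy' : dist (1 : G) y < (1 + K)⁻¹ * r := by rw [dist_comm]; exact hy
      rw [lt_inv_mul_iff₀ (by positivity)] at hy'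
      have h1 := hψK n (n • conjContinuousMulEquiv N (ψ n : G) y)
      rw [mem_preimage, mem_ball, dist_comm, dist_graphMap]
      simp only [smul_eq_mul, inv_mul_cancel_left, ContinuousMulEquiv.symm_apply_apply] at h1 ⊢
      refine (dist_one_mul_le _ _).trans_lt ?_
      linarith
    refine le_trans ?_ (measure_mono hsub)
    rw [measure_smul]
    have h1 := (hm 1 ((1 + K)⁻¹ * r) (by positivity)).1.trans
      (measure_le_measure_image_conj hc hC hm (ψ n : G) (ball 1 ((1 + K)⁻¹ * r)))
    calc ENNReal.ofReal (A⁻¹ * (c * (1 + K)⁻¹ ^ Q) * r ^ Q)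
        = ENNReal.ofReal A⁻¹ * ENNReal.ofReal (c * ((1 + K)⁻¹ * r) ^ Q) := by
          rw [← ENNReal.ofReal_mul (by positivity), Real.mul_rpow (by positivity) hr.le]
          ring_nf
      _ ≤ ENNReal.ofReal A⁻¹ * (ENNReal.ofReal A * _) := by gcongr
      _ = _ := by
          rw [← mul_assoc, ← ENNReal.ofReal_mul (by positivity), inv_mul_cancel₀ hA.ne',
            ENNReal.ofReal_one, one_mul]
  · have hsub : graphMap ψ ⁻¹' ball (graphMap ψ n) r ⊆
        n • (conjContinuousMulEquiv N (ψ n : G) '' ball 1 (M * r)) := by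
      intro n' hn'
      rw [mem_preimage, mem_ball, dist_comm, dist_graphMap] at hn'
      refine ⟨n⁻¹ * n', ⟨(conjContinuousMulEquiv N (ψ n : G)).symm (n⁻¹ * n'), ?_, by simp⟩,
        by simp⟩
      rw [mem_ball, dist_comm]
      exact (hproj _ (SetLike.coe_mem _) _ (SetLike.coe_mem _)).trans_lt
        (mul_lt_mul_of_pos_left hn' hM)
    refine (measure_mono hsub).trans ?_
    rw [measure_smul]
    calc m (conjContinuousMulEquiv N (ψ n : G) '' ball 1 (M * r))
        ≤ ENNReal.ofReal A * m (ball 1 (M * r)) := measure_image_conj_le hc hC hm _ _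
      _ ≤ ENNReal.ofReal A * ENNReal.ofReal (C * (M * r) ^ Q) := by
          gcongr; exact (hm 1 _ (by positivity)).2
      _ = _ := by
          rw [← ENNReal.ofReal_mul hA.le, Real.mul_rpow hM.le hr.le]
          ring_nf

/-- If the preimages of balls centred on the range of `Φ` have `m`-measure comparable to `r ^ Q`,
the range is regular for the image measure and, viewed as a metric space in its own right, for the
Hausdorff measure. -/
theorem isLocallyAhlforsRegular_range {X Y : Type*} [TopologicalSpace X] [MeasurableSpace X]
    [BorelSpace X] [MetricSpace Y] [MeasurableSpace Y] [BorelSpace Y] {Φ : X → Y}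
    (hΦ : Continuous Φ) {m : Measure X} {Q c C : ℝ} (hQ : 0 ≤ Q) (hc : 0 < c) (hC : 0 < C)
    (h : ∀ (x : X) (r : ℝ), 0 < r → ENNReal.ofReal (c * r ^ Q) ≤ m (Φ ⁻¹' ball (Φ x) r) ∧
      m (Φ ⁻¹' ball (Φ x) r) ≤ ENNReal.ofReal (C * r ^ Q)) :
    IsLocallyAhlforsRegular (m.map Φ) (range Φ) Q ∧
      IsLocallyAhlforsRegular (Measure.hausdorffMeasure Q : Measure Y) (range Φ) Q := by
  constructor
  · refine .of_forall_ball hc hC ?_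
    rintro _ ⟨x, rfl⟩ r hr
    constructor
    · -- The range need not be measurable: only inequalities for the image measure are available.
      refine (h x r hr).1.trans (le_trans (measure_mono fun y hy => ?_)
        (Measure.le_map_apply hΦ.measurable.aemeasurable _))
      exact ⟨hy, mem_range_self y⟩
    · refine (measure_mono inter_subset_left).trans ?_
      rw [Measure.map_apply hΦ.measurable measurableSet_ball]
      exact (h x r hr).2
  · have hΦ' : Measurable (rangeFactorization Φ) := (hΦ.subtype_mk _).measurable
    have hreg : IsUniformlyAhlforsRegular (m.map (rangeFactorization Φ)) Q := by
      refine ⟨c, C, hc, hC, ?_⟩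
      rintro ⟨_, x, rfl⟩ r hr
      rw [Measure.map_apply hΦ' measurableSet_ball]
      exact h x r hr
    obtain ⟨c', C', hc', hC', h'⟩ := hreg.hausdorffMeasure hQ
    refine .of_forall_ball hc' hC' fun y hy r hr => ?_
    have himage : Subtype.val '' ball (⟨y, hy⟩ : range Φ) r = ball y r ∩ range Φ := by
      rw [inter_comm, ← Subtype.image_preimage_coe]; rfl
    rw [← himage, (isometry_subtype_coe (s := range Φ)).hausdorffMeasure_image (Or.inl hQ)]
    exact h' _ r hr

end Graph

/-! ### Homogeneous distances on Carnot groups -/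

namespace CarnotStructure

variable {E : Type*} [NormedAddCommGroup E] [NormedSpace ℝ E] {G : Type*} [MetricSpace G]
  [ChartedSpace E G] [Group G] {S : CarnotStructure E G}

theorem IsHomogeneousDist.isIsometricSMul (hS : S.IsHomogeneousDist) : IsIsometricSMul G G :=
  ⟨fun g => Isometry.of_dist_eq fun x y => hS.dist_mul_left g x y⟩

theorem IsHomogeneousDist.dil_one (hS : S.IsHomogeneousDist) (g : G) : S.dil 1 g = g := by
  have h := hS.dist_dil 1 one_pos (S.dil 1 g) g
  rw [← S.dil_mul 1 1 one_pos one_pos, mul_one, dist_self, one_mul] at h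
  exact dist_eq_zero.1 h.symm

theorem IsHomogeneousDist.dil_inv_dil (hS : S.IsHomogeneousDist) {t : ℝ} (ht : 0 < t) (g : G) :
    S.dil t⁻¹ (S.dil t g) = g := by
  rw [← S.dil_mul _ _ (inv_pos.2 ht) ht, inv_mul_cancel₀ ht.ne', hS.dil_one]

theorem IsHomogeneousDist.dil_dil_inv (hS : S.IsHomogeneousDist) {t : ℝ} (ht : 0 < t) (g : G) :
    S.dil t (S.dil t⁻¹ g) = g := by
  rw [← S.dil_mul _ _ ht (inv_pos.2 ht), mul_inv_cancel₀ ht.ne', hS.dil_one]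

theorem IsHomogeneousDist.dist_one_dil (hS : S.IsHomogeneousDist) {t : ℝ} (ht : 0 < t) (g : G) :
    dist 1 (S.dil t g) = t * dist 1 g := by
  rw [← hS.dist_dil t ht, map_one]

theorem IsHomogeneousDist.continuous_dil (hS : S.IsHomogeneousDist) {t : ℝ} (ht : 0 < t) :
    Continuous (S.dil t) :=
  (LipschitzWith.of_dist_le_mul (K := ⟨t, ht.le⟩) fun x y => (hS.dist_dil t ht x y).le).continuous

/-- Closed balls of arbitrary radius are images of small closed balls under left translations and
dilations. -/
theorem IsHomogeneousDist.properSpace [LocallyCompactSpace G] (hS : S.IsHomogeneousDist) :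
    ProperSpace G := by
  have := hS.isIsometricSMul
  obtain ⟨ε, hε, hcomp⟩ := exists_isCompact_closedBall (1 : G)
  refine ProperSpace.of_isCompact_closedBall_of_le 1 fun x r hr => ?_
  have ht : 0 < r / ε := div_pos (by linarith) hε
  have hcont : Continuous fun g => x * S.dil (r / ε) g :=
    (isometry_smul G x).continuous.comp (hS.continuous_dil ht)
  refine (hcomp.image hcont).of_isClosed_subset isClosed_closedBall fun y hy => ?_
  refine ⟨S.dil (r / ε)⁻¹ (x⁻¹ * y), ?_, by simp only [hS.dil_dil_inv ht, mul_inv_cancel_left]⟩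
  rw [mem_closedBall, dist_comm, hS.dist_one_dil (inv_pos.2 ht), ← hS.dist_mul_left x, mul_one,
    mul_inv_cancel_left, inv_div, div_mul_eq_mul_div, div_le_iff₀ (by linarith), dist_comm]
  exact mul_le_mul_of_nonneg_left hy hε.le

/-- The dilation of factor `t` of a homogeneous subgroup. -/
noncomputable def IsHomogeneousSubgroup.dilEquiv {P : Subgroup G} (hP : S.IsHomogeneousSubgroup P)
    (hS : S.IsHomogeneousDist) {t : ℝ} (ht : 0 < t) : P ≃ₜ* P where
  toFun x := ⟨S.dil t x, hP.dil_mem t ht x x.2⟩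
  invFun x := ⟨S.dil t⁻¹ x, hP.dil_mem t⁻¹ (inv_pos.2 ht) x x.2⟩
  left_inv x := Subtype.ext (hS.dil_inv_dil ht x)
  right_inv x := Subtype.ext (hS.dil_dil_inv ht x)
  map_mul' x y := Subtype.ext (map_mul (S.dil t) (x : G) y)
  continuous_toFun := ((hS.continuous_dil ht).comp continuous_subtype_val).subtype_mk _
  continuous_invFun :=
    ((hS.continuous_dil (inv_pos.2 ht)).comp continuous_subtype_val).subtype_mk _

/-- Homogeneity of the projection `π_N`: by dilation it suffices to bound `d(1, n h)` from below on
the compact set where `d(1, n) + d(1, h) = 1`, and there it does not vanish. -/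
theorem exists_dist_le_mul_dist_mul [IsTopologicalGroup G] [ProperSpace G]
    (hS : S.IsHomogeneousDist) {N H : Subgroup G} (hN : S.IsHomogeneousSubgroup N)
    (hH : S.IsHomogeneousSubgroup H) (hNH : Disjoint N H) :
    ∃ M : ℝ, 0 < M ∧ ∀ n ∈ N, ∀ h ∈ H, dist 1 n ≤ M * dist 1 (n * h) := by
  set T : Set (G × G) := {p | p.1 ∈ N ∧ p.2 ∈ H ∧ dist 1 p.1 + dist 1 p.2 = 1} with hT
  have hclosed : IsClosed T := by
    refine (hN.isClosed.preimage continuous_fst).inter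
      ((hH.isClosed.preimage continuous_snd).inter (isClosed_eq ?_ continuous_const))
    fun_prop
  have hcomp : IsCompact T := by
    have hball := isCompact_closedBall (1 : G) 1
    refine (hball.prod hball).of_isClosed_subset hclosed fun p hp => ⟨?_, ?_⟩ <;> rw [mem_closedBall, dist_comm]
    · linarith [hp.2.2, dist_nonneg (x := 1) (y := p.2)]
    · linarith [hp.2.2, dist_nonneg (x := 1) (y := p.1)]
  have hpos : ∀ p ∈ T, 0 < dist 1 (p.1 * p.2) := by
    rintro ⟨n, h⟩ ⟨hn, hh, hsum⟩
    refine dist_pos.2 fun heq => ?_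
    have hn1 : n = 1 := by
      refine Subgroup.disjoint_def.1 hNH hn ?_
      exact (eq_inv_of_mul_eq_one_left heq.symm : n = h⁻¹) ▸ H.inv_mem hh
    subst hn1
    have hh1 : h = 1 := by simpa using heq.symm
    subst hh1
    simp at hsum
  obtain ⟨δ, hδ, hδT⟩ := hcomp.exists_forall_le' (f := fun p : G × G => dist 1 (p.1 * p.2))
    (by fun_prop) hpos
  refine ⟨δ⁻¹, inv_pos.2 hδ, fun n hn h hh => ?_⟩
  set s : ℝ := dist 1 n + dist 1 h with hs
  have hns : dist 1 n ≤ s := le_add_of_nonneg_right dist_nonneg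
  rcases (show 0 ≤ s by positivity).eq_or_lt with hs0 | hs0
  · rw [← hs0] at hns
    exact hns.trans (by positivity)
  · have hs' := inv_pos.2 hs0
    have h1 := hδT (S.dil s⁻¹ n, S.dil s⁻¹ h) ⟨hN.dil_mem _ hs' n hn, hH.dil_mem _ hs' h hh, by
      rw [hS.dist_one_dil hs', hS.dist_one_dil hs', ← mul_add, ← hs, inv_mul_cancel₀ hs0.ne']⟩
    simp only [← map_mul, hS.dist_one_dil hs'] at h1
    rw [le_inv_mul_iff₀ hs0] at h1
    rw [le_inv_mul_iff₀ hδ]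
    nlinarith

end CarnotStructure

theorem mainTheorem7 {E : Type*} [NormedAddCommGroup E] [NormedSpace ℝ E] [FiniteDimensional ℝ E]
    {G : Type*} [MetricSpace G] [ChartedSpace E G] [Group G] [LieGroup 𝓘(ℝ, E) ∞ G]
    [SimplyConnectedSpace G] [MeasurableSpace G] [BorelSpace G]
    (S : CarnotStructure E G) (hdist : S.IsHomogeneousDist)
    (N H : Subgroup G) (hN : S.IsHomogeneousSubgroup N) (hH : S.IsHomogeneousSubgroup H)
    (hnormal : N.Normal) (hNH : Subgroup.IsComplement' N H) :
    ∃ Q : ℝ, 0 ≤ Q ∧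
      IsLocallyAhlforsRegular (MeasureTheory.Measure.hausdorffMeasure Q : MeasureTheory.Measure N)
        Set.univ Q ∧
      ∀ ψ : N → H, IsFSSCLipschitz hNH ψ →
        IsLocallyAhlforsRegular
          (MeasureTheory.Measure.map (graphMap ψ)
            (MeasureTheory.Measure.hausdorffMeasure Q : MeasureTheory.Measure N))
          (intrinsicGraph ψ) Q ∧
        IsLocallyAhlforsRegular
          (MeasureTheory.Measure.hausdorffMeasure Q : MeasureTheory.Measure G)
          (intrinsicGraph ψ) Q := by
  have := topologicalGroup_of_lieGroup 𝓘(ℝ, E) ∞ (G := G)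
  have := Manifold.locallyCompact_of_finiteDimensional 𝓘(ℝ, E) (M := G)
  have := hdist.isIsometricSMul
  have := hdist.properSpace
  have : ProperSpace N := ProperSpace.of_isClosed hN.isClosed
  have : IsIsometricSMul N N :=
    ⟨fun g => Isometry.of_dist_eq fun x y => hdist.dist_mul_left g x y⟩
  obtain ⟨Q, hQ, hreg⟩ := exists_isUniformlyAhlforsRegular_of_dilation (Measure.haar : Measure N)
    (hN.dilEquiv hdist two_pos) fun x y => hdist.dist_dil 2 two_pos x y
  replace hreg := hreg.hausdorffMeasure hQ
  have := hreg.isHaarMeasure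
  obtain ⟨M, hM, hproj⟩ := CarnotStructure.exists_dist_le_mul_dist_mul hdist hN hH hNH.disjoint
  refine ⟨Q, hQ, ?_, fun ψ hψ => ?_⟩
  · obtain ⟨c, C, hc, hC, h⟩ := hreg
    exact .of_forall_ball hc hC fun x _ r hr => by simpa using h x r hr
  · obtain ⟨c, C, hc, hC, h⟩ := hψ.measure_preimage_ball hM hproj hreg
    exact isLocallyAhlforsRegular_range hψ.continuous_graphMap hQ hc hC h
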